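/- Identify each subset of $\omega$ with its characteristic function, so that a filter on $\omega$ is a subset of $2^{\omega}$. All filters are proper and nonprincipal, i.e. they do not contain $\emptyset$ and contain every cofinite subset of $\omega$. For a sequence $\hat p = (p_n)_{n\in\omega}$ with $p_n \in (0,\tfrac12]$ let $\mu_{\hat p}$ be the product measure on $2^{\omega}$ with $\mu_{\hat p}(\{x : x(n)=1\}) = p_n$ and $\mu_{\hat p}(\{x : x(n)=0\}) = 1-p_n$ for all $n$; Lebesgue measure on $2^\omega$ is the case where $p_n = \tfrac12$ for all $n$. A set is $\mu_{\hat p}$-nonmeasurable if it is not measurable with respect to the completion of $\mu_{\hat p}$. Assume Martin's Axiom. Let $\hat p$ be a sequence in $(0,\tfrac12]$ with $\lim_{n\to\infty} p_n = 0$, let $0 < \lambda < 2^{\aleph_0}$, and let $\{\mathcal F_\xi : \xi < \lambda\}$ be a family of $\mu_{\hat p}$-nonmeasurable filters on $\omega$. Then $\bigcap_{\xi<\lambda}\mathcal F_\xi$ is a Lebesgue nonmeasurable filter. In fact, it is $\mu_{\hat q}$-nonmeasurable for every sequence $\hat q = (q_n)_{n\in\omega}$ in $(0,\tfrac12]$ such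 that $\lim_{n\to\infty} q_n/p_n = \infty$. -/

import Mathlib

open MeasureTheory ProbabilityTheory Filter Topology

/-- Two conditions of a notion of forcing are compatible if they have a common extension
(smaller elements are stronger conditions). -/
def ForcingCompatible {P : Type*} [Preorder P] (a b : P) : Prop :=
  ∃ c, c ≤ a ∧ c ≤ b

/-- The countable chain condition: every set of pairwise incompatible conditions is countable. -/
def IsCCC (P : Type*) [Preorder P] : Prop :=
  ∀ A : Set P, (A.Pairwise fun a b => ¬ ForcingCompatible a b) → A.Countable

/-- A set of conditions is dense if every condition has an extension in it. -/
def IsForcingDense {P : Type*} [Preorder P] (D : Set P) : Prop :=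
  ∀ a, ∃ d ∈ D, d ≤ a

/-- Martin's Axiom: for every nonempty ccc notion of forcing and every family of fewer than
`2 ^ ℵ₀` dense sets there is a filter that meets all of them. -/
def MartinsAxiom : Prop :=
  ∀ (P : Type) [Preorder P] [Nonempty P], IsCCC P →
    ∀ 𝒟 : Set (Set P), Cardinal.mk 𝒟 < Cardinal.continuum → (∀ D ∈ 𝒟, IsForcingDense D) →
      ∃ G : Order.PFilter P, ∀ D ∈ 𝒟, ((G : Set P) ∩ D).Nonempty

/-- A real number in `(0, 1/2]`, as an element of the unit interval. -/
def toUnit (t : Set.Ioc (0 : ℝ) (1 / 2)) : unitInterval :=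
  ⟨t, t.2.1.le, t.2.2.trans (by norm_num)⟩

/-- The product measure on `2 ^ ω` that gives `{x | x n = 1}` mass `p n`
and `{x | x n = 0}` mass `1 - p n`. -/
noncomputable def muHat (p : ℕ → Set.Ioc (0 : ℝ) (1 / 2)) : Measure (ℕ → Bool) :=
  Measure.infinitePi fun n => bernoulliMeasure true false (toUnit (p n))

/-- The usual (Lebesgue) measure on `2 ^ ω`: all the parameters are `1/2`. -/
noncomputable def cantorLebesgue : Measure (ℕ → Bool) :=
  muHat fun _ => ⟨1 / 2, by norm_num, le_rfl⟩

/-- A filter on `ω`, in the sense of a proper nonprincipal filter: it omits the empty set and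
contains all cofinite sets. -/
def IsNonprincipalFilter (F : Filter ℕ) : Prop :=
  F.NeBot ∧ F ≤ cofinite

/-- The set of characteristic functions of the elements of a filter on `ω`. -/
def charFunctions (F : Filter ℕ) : Set (ℕ → Bool) :=
  {x | {n | x n = true} ∈ F}

/-- A filter on `ω` is nonmeasurable for `μ` if the set of characteristic functions of its elements
is not measurable for the completion of `μ`. -/
def NonmeasurableFilter (μ : Measure (ℕ → Bool)) (F : Filter ℕ) : Prop :=
  ¬ NullMeasurableSet (charFunctions F) μ

/-! By Kolmogorov's zero-one law, and since two random sets with parameters at most `1 / 2` can be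
coupled to be disjoint, a measurable nonprincipal filter is null. So nonmeasurability means positive
outer measure, and it must be shown that the intersection of the filters is not `muHat q`-null
(`muHat_charFunctions_iSup_ne_zero`).

If it were null, it would lie in the limsup of very small sets `J l`, each depending on two
consecutive blocks of an interval partition (`exists_two_block_cover`). A set `Z` in every filter
that is eventually outside these sets is a contradiction. `Z` is built on the odd blocks so that
each remaining conditional probability is small, then on the even blocks so that `J l` is avoided on
both sides.

Both stages use `exists_block_cover`: on each block, a set outside a small family must cover the
trace of a member of every filter, for almost all blocks. As `q / p → ∞`, a `q`-random set on the
`m`-th block is the union of up to `m` independent `p`-random sets and a residual one. Adding one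
`p`-random trace therefore raises the conditional probability of the bad family by more than a
factor `8 ^ m` with probability at most `(8 ^ m)⁻¹`, and the bound `smallBound m` survives `m` such
losses. Under Martin's Axiom slaloms of linear width capture all finite unions of fewer than
continuum many traces, so Borel–Cantelli yields suitable members by transfinite recursion. A second
use of Martin's Axiom merges the finite unions into one cover. -/

/-! ### Martin's Axiom as a covering principle -/

/-- Conditions for adding a function `ℕ → α`: a finite initial segment of admissible values,
and a finite set of indices to be covered from there on. -/
structure CoverCondition {ι α : Type} (adm : ℕ → α → Prop) (N : Finset ι → ℕ) : Type where
  /-- the length of the initial segment -/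
  len : ℕ
  /-- the function, of which only the values below `len` count -/
  val : ℕ → α
  /-- the indices to be covered -/
  idx : Finset ι
  le_len : N idx ≤ len
  adm_val : ∀ m < len, adm m (val m)

/-- The order relation of `CoverCondition`, relative to the covering relation `E`. -/
def CoverCondition.Extends {ι α : Type} {adm : ℕ → α → Prop} {N : Finset ι → ℕ}
    (E : ι → ℕ → α → Prop) (c d : CoverCondition adm N) : Prop :=
  d.len ≤ c.len ∧ (∀ m < d.len, c.val m = d.val m) ∧ d.idx ⊆ c.idx ∧
    ∀ m, d.len ≤ m → m < c.len → ∀ ξ ∈ d.idx, E ξ m (c.val m)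

lemma CoverCondition.extends_refl {ι α : Type} {adm : ℕ → α → Prop} {N : Finset ι → ℕ}
    (E : ι → ℕ → α → Prop) (c : CoverCondition adm N) : c.Extends E c :=
  ⟨le_rfl, fun _ _ => rfl, subset_rfl, fun _ h₁ h₂ => absurd h₂ (not_lt.2 h₁)⟩

lemma CoverCondition.Extends.trans {ι α : Type} {adm : ℕ → α → Prop} {N : Finset ι → ℕ}
    {E : ι → ℕ → α → Prop} {a b c : CoverCondition adm N}
    (hab : a.Extends E b) (hbc : b.Extends E c) : a.Extends E c := by
  refine ⟨hbc.1.trans hab.1, fun m hm => ?_, hbc.2.2.1.trans hab.2.2.1, fun m h₁ h₂ ξ hξ => ?_⟩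
  · rw [hab.2.1 m (hm.trans_le hbc.1), hbc.2.1 m hm]
  · rcases lt_or_ge m b.len with h | h
    · rw [hab.2.1 m h]
      exact hbc.2.2.2 m h₁ h ξ hξ
    · exact hab.2.2.2 m h h₂ ξ (hbc.2.2.1 hξ)

/-- Two conditions with the same initial segment have a common extension, which contains any
given finite set of indices and is as long as one likes. -/
lemma CoverCondition.exists_extends {ι α : Type} {adm : ℕ → α → Prop} {N : Finset ι → ℕ}
    {E : ι → ℕ → α → Prop} [DecidableEq ι]
    (hE : ∀ A B : Finset ι, ∀ m, N A ≤ m → N B ≤ m →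
      ∃ h, adm m h ∧ (∀ ξ ∈ A, E ξ m h) ∧ ∀ ξ ∈ B, E ξ m h)
    (c d : CoverCondition adm N) (hlen : c.len = d.len) (hval : ∀ m < c.len, c.val m = d.val m)
    (A : Finset ι) (k : ℕ) :
    ∃ e : CoverCondition adm N, e.Extends E c ∧ e.Extends E d ∧ A ⊆ e.idx ∧ k ≤ e.len := by
  have hex : ∀ m, ∃ h, c.len ≤ m →
      adm m h ∧ (∀ ξ ∈ c.idx, E ξ m h) ∧ ∀ ξ ∈ d.idx, E ξ m h := by
    intro m
    by_cases hm : c.len ≤ m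
    · obtain ⟨h, hh⟩ := hE c.idx d.idx m (c.le_len.trans hm) (d.le_len.trans (hlen ▸ hm))
      exact ⟨h, fun _ => hh⟩
    · exact ⟨c.val m, fun h => absurd h hm⟩
  choose g hg using hex
  refine ⟨⟨max (max c.len k) (N (c.idx ∪ d.idx ∪ A)),
    fun m => if m < c.len then c.val m else g m, c.idx ∪ d.idx ∪ A, le_max_right _ _, ?_⟩,
    ⟨?_, ?_, ?_, ?_⟩, ⟨?_, ?_, ?_, ?_⟩, ?_, ?_⟩
  · intro m _
    by_cases hm : m < c.len
    · simpa [hm] using c.adm_val m hm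
    · simpa [hm] using (hg m (not_lt.1 hm)).1
  · simp
  · intro m hm
    simp [hm]
  · intro ξ hξ
    simp [hξ]
  · intro m hm _ ξ hξ
    simpa [not_lt.2 hm] using (hg m hm).2.1 ξ hξ
  · simp [← hlen]
  · intro m hm
    rw [← hlen] at hm
    simp [hm, hval m hm]
  · intro ξ hξ
    simp [hξ]
  · intro m hm _ ξ hξ
    rw [← hlen] at hm
    simpa [not_lt.2 hm] using (hg m hm).2.2 ξ hξ
  · intro ξ hξ
    simp [hξ]
  · simp

/-- The combinatorial form of Martin's Axiom used below: if any two finite sets of indices can be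
covered simultaneously, by admissible values, from the maximum of their thresholds on, then a
single function with admissible values eventually covers every index. -/
theorem MartinsAxiom.exists_eventually_cover (hMA : MartinsAxiom) {ι α : Type} [Countable α]
    (hι : Cardinal.mk ι < Cardinal.continuum) (adm : ℕ → α → Prop) (E : ι → ℕ → α → Prop)
    (N : Finset ι → ℕ)
    (hE : ∀ A B : Finset ι, ∀ m, N A ≤ m → N B ≤ m →
      ∃ h, adm m h ∧ (∀ ξ ∈ A, E ξ m h) ∧ ∀ ξ ∈ B, E ξ m h)
    (hadm : ∀ m, ∃ h, adm m h) :
    ∃ h : ℕ → α, (∀ m, adm m (h m)) ∧ ∀ ξ, ∀ᶠ m in atTop, E ξ m (h m) := by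
  classical
  choose g hg using hadm
  let _ : Preorder (CoverCondition adm N) :=
    { le := fun c d => c.Extends E d
      le_refl := fun c => c.extends_refl E
      le_trans := fun _ _ _ => CoverCondition.Extends.trans }
  have : Nonempty (CoverCondition adm N) := ⟨⟨N ∅, g, ∅, le_rfl, fun m _ => hg m⟩⟩
  have hccc : IsCCC (CoverCondition adm N) := by
    intro A hA
    -- There are countably many initial segments, and conditions that share one are compatible.
    let code : CoverCondition adm N → List α := fun c => (List.range c.len).map c.val
    refine Set.countable_of_injective_of_countable_image (f := code) ?_ (Set.to_countable _)
    intro c hc d hd hcd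
    by_contra hne
    have hlen : c.len = d.len := by simpa [code] using congrArg List.length hcd
    refine hA hc hd hne ?_
    obtain ⟨e, hec, hed, -⟩ := CoverCondition.exists_extends hE c d hlen (fun m hm => by
      have : (code c)[m]? = (code d)[m]? := by rw [hcd]
      simpa [code, hm, ← hlen] using this) ∅ 0
    exact ⟨e, hec, hed⟩
  let D : ι ⊕ ℕ → Set (CoverCondition adm N) :=
    Sum.elim (fun ξ => {c | ξ ∈ c.idx}) (fun m => {c | m ≤ c.len})
  obtain ⟨G, hG⟩ := hMA (CoverCondition adm N) hccc (Set.range D)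
    (by
      refine (Cardinal.mk_range_le).trans_lt ?_
      rw [Cardinal.mk_sum]
      simpa using Cardinal.add_lt_of_lt Cardinal.aleph0_le_continuum hι
        Cardinal.aleph0_lt_continuum)
    (by
      rintro _ ⟨i, rfl⟩ c
      rcases i with ξ | m
      · obtain ⟨e, hec, -, he, -⟩ :=
          CoverCondition.exists_extends hE c c rfl (fun _ _ => rfl) {ξ} 0
        exact ⟨e, Finset.singleton_subset_iff.1 he, hec⟩
      · obtain ⟨e, hec, -, -, he⟩ :=
          CoverCondition.exists_extends hE c c rfl (fun _ _ => rfl) ∅ m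
        exact ⟨e, he, hec⟩)
  have hlong : ∀ m, ∃ c ∈ G, m < c.len := fun m => by
    obtain ⟨c, hcG, hc⟩ := hG _ ⟨Sum.inr (m + 1), rfl⟩
    exact ⟨c, hcG, hc⟩
  choose c hcG hc using hlong
  have hdir : ∀ a ∈ G, ∀ b ∈ G, ∃ e ∈ G, e.Extends E a ∧ e.Extends E b := by
    intro a ha b hb
    obtain ⟨e, he, hea, heb⟩ := G.directed a ha b hb
    exact ⟨e, he, hea, heb⟩
  -- Conditions in `G` have common extensions, so the value at `m` does not depend on which long
  -- enough condition is read.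
  refine ⟨fun m => (c m).val m, fun m => (c m).adm_val m (hc m), fun ξ => ?_⟩
  obtain ⟨d, hdG, hd⟩ := hG _ ⟨Sum.inl ξ, rfl⟩
  filter_upwards [eventually_ge_atTop d.len] with m hm
  obtain ⟨e, -, hec, hed⟩ := hdir (c m) (hcG m) d hdG
  rw [← hec.2.1 m (hc m)]
  exact hed.2.2.2 m hm ((hc m).trans_le hec.1) ξ hd

/-- Under Martin's Axiom fewer than continuum many functions into a countable set are eventually
captured by a single slalom of linear width. -/
theorem MartinsAxiom.exists_slalom (hMA : MartinsAxiom) {ι α : Type} [Countable α]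
    (hι : Cardinal.mk ι < Cardinal.continuum) (f : ι → ℕ → α) :
    ∃ S : ℕ → Finset α, (∀ m, (S m).card ≤ 2 * m + 1) ∧ ∀ ξ, ∀ᶠ m in atTop, f ξ m ∈ S m := by
  classical
  -- With the cardinality as threshold, `A ∪ B` contributes at most `2 * m` values. The extra one
  -- lets a constant singleton count as a slalom at `m = 0` in later uses.
  refine hMA.exists_eventually_cover hι (fun m (h : Finset α) => h.card ≤ 2 * m + 1)
    (fun ξ m h => f ξ m ∈ h) Finset.card (fun A B m hA hB => ?_) (fun m => ⟨∅, by simp⟩)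
  refine ⟨(A ∪ B).image (f · m), ?_, fun ξ hξ => Finset.mem_image_of_mem _ (by simp [hξ]),
    fun ξ hξ => Finset.mem_image_of_mem _ (by simp [hξ])⟩
  have h₁ := Finset.card_image_le (s := A ∪ B) (f := (f · m))
  have h₂ := Finset.card_union_le A B
  omega

/-! ### Couplings of product measures -/

/-- The coordinatewise image of a product of two infinite product measures is the product of the
coordinatewise images. -/
theorem map_prod_infinitePi {ι : Type*} {X Y Z : ι → Type*} [∀ i, MeasurableSpace (X i)]
    [∀ i, MeasurableSpace (Y i)] [∀ i, MeasurableSpace (Z i)]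
    (μ : ∀ i, Measure (X i)) (ν : ∀ i, Measure (Y i))
    [∀ i, IsProbabilityMeasure (μ i)] [∀ i, IsProbabilityMeasure (ν i)]
    (f : ∀ i, X i × Y i → Z i) (hf : ∀ i, Measurable (f i)) :
    ((Measure.infinitePi μ).prod (Measure.infinitePi ν)).map (fun z i => f i (z.1 i, z.2 i)) =
      Measure.infinitePi fun i => ((μ i).prod (ν i)).map (f i) := by
  have (i : ι) : IsProbabilityMeasure (((μ i).prod (ν i)).map (f i)) :=
    Measure.isProbabilityMeasure_map (hf i).aemeasurable
  have hm : Measurable fun (z : (∀ i, X i) × (∀ i, Y i)) i => f i (z.1 i, z.2 i) := by fun_prop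
  refine Measure.eq_infinitePi _ fun s t ht => ?_
  have hbox : MeasurableSet ((s : Set ι).pi t) := .pi s.countable_toSet fun i _ => ht i
  rw [Measure.map_apply hm hbox, Measure.prod_apply (hm hbox)]
  have hinner : ∀ x : ∀ i, X i, Measure.infinitePi ν
      (Prod.mk x ⁻¹' ((fun (z : (∀ i, X i) × (∀ i, Y i)) i => f i (z.1 i, z.2 i)) ⁻¹'
        (s : Set ι).pi t)) = ∏ i ∈ s, ν i (Prod.mk (x i) ⁻¹' (f i ⁻¹' t i)) := by
    intro x
    rw [← Measure.infinitePi_pi ν fun i _ => measurable_prodMk_left (hf i (ht i))]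
    congr 1
  simp_rw [hinner]
  have hg : ∀ i, Measurable fun a : X i => ν i (Prod.mk a ⁻¹' (f i ⁻¹' t i)) := fun i =>
    measurable_measure_prodMk_left (hf i (ht i))
  rw [lintegral_prod_eq_prod_lintegral_of_indepFun s
    (fun i (x : ∀ i, X i) => ν i (Prod.mk (x i) ⁻¹' (f i ⁻¹' t i)))
    (iIndepFun_infinitePi (P := μ) (X := fun i a => ν i (Prod.mk a ⁻¹' (f i ⁻¹' t i))) hg)
    (fun i => (hg i).comp (measurable_pi_apply i))]
  refine Finset.prod_congr rfl fun i _ => ?_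
  rw [Measure.map_apply (hf i) (ht i), Measure.prod_apply (hf i (ht i)),
    ← (measurePreserving_eval_infinitePi μ i).lintegral_comp (hg i)]

/-- The product measure on `ℕ → Bool` that gives `{x | x n = true}` mass `a n`. -/
noncomputable def bernoulliPi (a : ℕ → unitInterval) : Measure (ℕ → Bool) :=
  Measure.infinitePi fun n => bernoulliMeasure true false (a n)

instance (a : ℕ → unitInterval) : IsProbabilityMeasure (bernoulliPi a) := by
  unfold bernoulliPi; infer_instance

lemma bernoulliMeasure_false (a : unitInterval) :
    bernoulliMeasure true false a {false} = ENNReal.ofReal (1 - a) := by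
  rw [bernoulliMeasure_apply_of_notMem_of_mem _ (by simp) (by simp) (by simp)]
  rw [ENNReal.ofReal, ENNReal.coe_inj]
  ext
  simp [unitInterval.coe_symm_eq, a.2.2]

lemma bernoulliMeasure_true (a : unitInterval) :
    bernoulliMeasure true false a {true} = ENNReal.ofReal a := by
  rw [bernoulliMeasure_apply_of_mem_of_notMem _ (by simp) (by simp) (by simp)]
  rw [ENNReal.ofReal, ENNReal.coe_inj]
  ext
  simp [a.2.1]

lemma measure_bool_ext {μ ν : Measure Bool} [IsProbabilityMeasure μ] [IsProbabilityMeasure ν]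
    (b : Bool) (h : μ {b} = ν {b}) : μ = ν := by
  have hc : ({b}ᶜ : Set Bool) = {!b} := by ext x; cases x <;> cases b <;> simp
  refine Measure.ext_of_singleton fun x => ?_
  rcases Bool.eq_or_eq_not x b with rfl | rfl
  · exact h
  · rw [← hc, prob_compl_eq_one_sub (by simp), prob_compl_eq_one_sub (by simp), h]

/-- `E` depends only on the coordinates in `I`. -/
def DependsOnCoords (I : Finset ℕ) (E : Set (ℕ → Bool)) : Prop :=
  ∀ x y : ℕ → Bool, (∀ i ∈ I, x i = y i) → x ∈ E → y ∈ E

lemma DependsOnCoords.eq_cylinder {I : Finset ℕ} {E : Set (ℕ → Bool)}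
    (hE : DependsOnCoords I E) : E = cylinder I (I.restrict '' E) := by
  ext x
  refine ⟨fun hx => ⟨x, hx, rfl⟩, ?_⟩
  rintro ⟨y, hy, hyx⟩
  exact hE y x (fun i hi => congrFun hyx ⟨i, hi⟩) hy

lemma DependsOnCoords.measurableSet {I : Finset ℕ} {E : Set (ℕ → Bool)}
    (hE : DependsOnCoords I E) : MeasurableSet E := by
  rw [hE.eq_cylinder]
  exact MeasurableSet.cylinder I (Set.toFinite _).measurableSet

lemma DependsOnCoords.bernoulliPi_congr {I : Finset ℕ} {E : Set (ℕ → Bool)}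
    (hE : DependsOnCoords I E) {a b : ℕ → unitInterval} (hab : ∀ i ∈ I, a i = b i) :
    bernoulliPi a E = bernoulliPi b E := by
  rw [hE.eq_cylinder, bernoulliPi, bernoulliPi,
    Measure.infinitePi_cylinder _ (Set.toFinite _).measurableSet,
    Measure.infinitePi_cylinder _ (Set.toFinite _).measurableSet]
  congr 2
  funext i
  rw [hab i i.2]

/-- The union of two independent random sets. -/
lemma bernoulliPi_or {I : Finset ℕ} {E : Set (ℕ → Bool)} (hE : DependsOnCoords I E)
    {a b c : ℕ → unitInterval}
    (habc : ∀ i ∈ I, 1 - (c i : ℝ) = (1 - (a i : ℝ)) * (1 - (b i : ℝ))) :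
    bernoulliPi c E = ∫⁻ x, bernoulliPi b {y | (fun n => x n || y n) ∈ E} ∂bernoulliPi a := by
  -- A point misses the union when it misses both independent sets, so the complementary
  -- probabilities multiply.
  let d : ℕ → unitInterval := fun n =>
    unitInterval.symm (unitInterval.symm (a n) * unitInterval.symm (b n))
  have hd : ∀ i ∈ I, c i = d i := fun i hi => by
    ext
    simp only [d, unitInterval.coe_symm_eq, Set.Icc.coe_mul]
    linarith [habc i hi]
  have hmap : ((bernoulliPi a).prod (bernoulliPi b)).map (fun z n => z.1 n || z.2 n) =
      bernoulliPi d := by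
    refine (map_prod_infinitePi (fun n => bernoulliMeasure true false (a n))
      (fun n => bernoulliMeasure true false (b n)) (fun _ z => z.1 || z.2)
      (fun _ => measurable_of_finite _)).trans ?_
    unfold bernoulliPi
    congr 1
    funext n
    have : IsProbabilityMeasure (((bernoulliMeasure true false (a n)).prod
        (bernoulliMeasure true false (b n))).map (fun z => z.1 || z.2)) :=
      Measure.isProbabilityMeasure_map (measurable_of_finite _).aemeasurable
    refine measure_bool_ext false ?_
    rw [Measure.map_apply (measurable_of_finite _) (by simp)]
    have : (fun z : Bool × Bool => z.1 || z.2) ⁻¹' {false} = {false} ×ˢ {false} := by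
      ext ⟨x, y⟩; simp
    rw [this, Measure.prod_prod, bernoulliMeasure_false, bernoulliMeasure_false,
      bernoulliMeasure_false, ← ENNReal.ofReal_mul (by linarith [(a n).2.2])]
    simp [d, unitInterval.coe_symm_eq]
  have hm : Measurable fun (z : (ℕ → Bool) × (ℕ → Bool)) n => z.1 n || z.2 n := by
    refine measurable_pi_lambda _ fun n => ?_
    exact (measurable_of_finite fun z : Bool × Bool => z.1 || z.2).comp
      (f := fun z : (ℕ → Bool) × (ℕ → Bool) => (z.1 n, z.2 n)) (by fun_prop)
  rw [hE.bernoulliPi_congr hd, ← hmap, Measure.map_apply hm hE.measurableSet,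
    Measure.prod_apply (hm hE.measurableSet)]
  rfl

/-- The restrictions of a random set to `B` and to the complement of `B` are independent. -/
lemma bernoulliPi_splice {E : Set (ℕ → Bool)} (hE : MeasurableSet E) (a : ℕ → unitInterval)
    (B : Finset ℕ) :
    bernoulliPi a E =
      ∫⁻ x, bernoulliPi a {y | (fun n => if n ∈ B then x n else y n) ∈ E} ∂bernoulliPi a := by
  have hf : ∀ n, Measurable fun z : Bool × Bool => if n ∈ B then z.1 else z.2 :=
    fun n => measurable_of_finite _
  have hmap : ((bernoulliPi a).prod (bernoulliPi a)).map
      (fun z n => if n ∈ B then z.1 n else z.2 n) = bernoulliPi a := by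
    refine (map_prod_infinitePi (fun n => bernoulliMeasure true false (a n))
      (fun n => bernoulliMeasure true false (a n)) (fun n z => if n ∈ B then z.1 else z.2)
      hf).trans ?_
    unfold bernoulliPi
    congr 1
    funext n
    by_cases hn : n ∈ B
    · simp only [hn, if_true]
      exact Measure.fst_prod
    · simp only [hn, if_false]
      exact Measure.snd_prod
  have hm : Measurable fun (z : (ℕ → Bool) × (ℕ → Bool)) n => if n ∈ B then z.1 n else z.2 n := by
    refine measurable_pi_lambda _ fun n => ?_
    exact (hf n).comp (f := fun z : (ℕ → Bool) × (ℕ → Bool) => (z.1 n, z.2 n)) (by fun_prop)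
  conv_lhs => rw [← hmap]
  rw [Measure.map_apply hm hE, Measure.prod_apply (hm hE)]
  rfl

/-! ### Measurable filters are null -/

/-- If `a n ≤ 1 / 2` for all `n`, then a set of full measure contains two disjoint sets. -/
lemma exists_disjoint_of_ae_mem {a : ℕ → unitInterval} (ha : ∀ n, (a n : ℝ) ≤ 1 / 2)
    {C : Set (ℕ → Bool)} (hC : ∀ᵐ x ∂bernoulliPi a, x ∈ C) :
    ∃ x ∈ C, ∃ y ∈ C, ∀ n, ¬ (x n = true ∧ y n = true) := by
  -- Thinning the complement of an `a`-random set by `r` gives a disjoint set that is again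
  -- `a`-random, as `(1 - a) * r = a`; `r ≤ 1` is where `a ≤ 1 / 2` enters.
  let r : ℕ → unitInterval := fun n => ⟨a n / (1 - a n),
    div_nonneg (a n).2.1 (by linarith [ha n]), by
      rw [div_le_one (by linarith [ha n])]; linarith [ha n]⟩
  have hf : Measurable fun z : Bool × Bool => !z.1 && z.2 := measurable_of_finite _
  have hmap : ((bernoulliPi a).prod (bernoulliPi r)).map (fun z n => !z.1 n && z.2 n) =
      bernoulliPi a := by
    refine (map_prod_infinitePi (fun n => bernoulliMeasure true false (a n))
      (fun n => bernoulliMeasure true false (r n)) (fun _ z => !z.1 && z.2)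
      (fun _ => hf)).trans ?_
    unfold bernoulliPi
    congr 1
    funext n
    have : IsProbabilityMeasure (((bernoulliMeasure true false (a n)).prod
        (bernoulliMeasure true false (r n))).map (fun z => !z.1 && z.2)) :=
      Measure.isProbabilityMeasure_map hf.aemeasurable
    refine measure_bool_ext true ?_
    rw [Measure.map_apply hf (by simp)]
    have : (fun z : Bool × Bool => !z.1 && z.2) ⁻¹' {true} = {false} ×ˢ {true} := by
      ext ⟨x, y⟩; simp
    rw [this, Measure.prod_prod, bernoulliMeasure_false, bernoulliMeasure_true,
      bernoulliMeasure_true, ← ENNReal.ofReal_mul (by linarith [(a n).2.2])]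
    congr 1
    have : (1 - (a n : ℝ)) ≠ 0 := by linarith [ha n]
    simp only [r]
    field_simp
  have hm : Measurable fun (z : (ℕ → Bool) × (ℕ → Bool)) n => !z.1 n && z.2 n := by
    refine measurable_pi_lambda _ fun n => ?_
    exact hf.comp (f := fun z : (ℕ → Bool) × (ℕ → Bool) => (z.1 n, z.2 n)) (by fun_prop)
  have h₁ : ∀ᵐ z ∂(bernoulliPi a).prod (bernoulliPi r), z.1 ∈ C :=
    Measure.quasiMeasurePreserving_fst.ae hC
  have h₂ : ∀ᵐ z ∂(bernoulliPi a).prod (bernoulliPi r), (fun n => !z.1 n && z.2 n) ∈ C := by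
    refine ae_of_ae_map hm.aemeasurable ?_
    rwa [hmap]
  obtain ⟨z, hz₁, hz₂⟩ := (h₁.and h₂).exists
  exact ⟨_, hz₁, _, hz₂, fun n => by cases z.1 n <;> simp⟩

/-- Kolmogorov's zero-one law: the outer measure of a set that is closed under finite changes
is zero or one. -/
lemma bernoulliPi_zero_or_one (a : ℕ → unitInterval) {C : Set (ℕ → Bool)}
    (htail : ∀ x y : ℕ → Bool, (∀ᶠ n in atTop, x n = y n) → x ∈ C → y ∈ C) :
    bernoulliPi a C = 0 ∨ bernoulliPi a C = 1 := by
  set M := toMeasurable (bernoulliPi a) C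
  have hM : MeasurableSet M := measurableSet_toMeasurable _ _
  -- `C` need not be measurable and its hull `M` need not be a tail set. `T` is both, and it lies
  -- between them; there are only countably many finite changes.
  let T : Set (ℕ → Bool) := {x | ∀ y : ℕ → Bool, (∀ᶠ n in atTop, x n = y n) → y ∈ M}
  let patch : Finset ℕ → Finset ℕ → (ℕ → Bool) → ℕ → Bool :=
    fun s t x n => if n ∈ s then decide (n ∈ t) else x n
  have hpatch : ∀ s t x, ∀ᶠ n in atTop, x n = patch s t x n := by
    intro s t x
    rw [← Nat.cofinite_eq_atTop]
    filter_upwards [s.eventually_cofinite_notMem] with n hn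
    simp [patch, hn]
  have hT : T = ⋂ (s : Finset ℕ) (t : Finset ℕ), patch s t ⁻¹' M := by
    ext x
    simp only [T, Set.mem_ofPred_eq, Set.mem_iInter, Set.mem_preimage]
    refine ⟨fun h s t => h _ (hpatch s t x), fun h y hy => ?_⟩
    obtain ⟨N, hN⟩ := eventually_atTop.1 hy
    have : y = patch (Finset.range N) ((Finset.range N).filter (y · = true)) x := by
      funext n
      by_cases hn : n < N
      · cases hyn : y n <;> simp [patch, hn, hyn]
      · simp [patch, hn, hN n (not_lt.1 hn)]
    rw [this]
    exact h _ _
  have hCT : C ⊆ T := fun x hx y hy => subset_toMeasurable _ _ (htail x y hy hx)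
  have hTM : T ⊆ M := fun x hx => hx x (Eventually.of_forall fun _ => rfl)
  have hμ : bernoulliPi a T = bernoulliPi a C :=
    le_antisymm ((measure_mono hTM).trans (measure_toMeasurable C).le) (measure_mono hCT)
  rw [← hμ]
  have hTinv : ∀ x y : ℕ → Bool, (∀ᶠ n in atTop, x n = y n) → x ∈ T → y ∈ T := by
    intro x y hxy hx z hz
    refine hx z ?_
    filter_upwards [hxy, hz] with n h₁ h₂ using h₁.trans h₂
  have hTmeas : MeasurableSet T := by
    rw [hT]
    refine MeasurableSet.iInter fun s => MeasurableSet.iInter fun t => ?_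
    refine (measurable_pi_lambda _ fun n => ?_) hM
    by_cases hn : n ∈ s
    · simp [patch, hn]
    · simpa [patch, hn] using measurable_pi_apply n
  refine measure_zero_or_one_of_measurableSet_limsup_atTop
    (s := fun n => MeasurableSpace.comap (fun x : ℕ → Bool => x n) inferInstance)
    (fun n => (measurable_pi_apply n).comap_le)
    (iIndepFun_infinitePi (P := fun n => bernoulliMeasure true false (a n)) (X := fun _ b => b)
      (fun _ => measurable_id)) ?_
  rw [limsup_eq_iInf_iSup_of_nat, MeasurableSpace.measurableSet_iInf]
  intro n
  -- Resetting the first `n` coordinates does not affect membership in `T`, so `T` is measurable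
  -- with respect to the coordinates from `n` on.
  have hTn : T = patch (Finset.range n) ∅ ⁻¹' T := by
    ext x
    refine ⟨hTinv _ _ (hpatch _ _ x), hTinv _ _ ?_⟩
    filter_upwards [hpatch (Finset.range n) ∅ x] with k hk using hk.symm
  rw [hTn]
  have hmeas : Measurable[⨆ i, ⨆ (_ : i ≥ n), MeasurableSpace.comap (fun x : ℕ → Bool => x i)
      inferInstance] (patch (Finset.range n) ∅) := by
    refine @measurable_pi_lambda _ _ _ (_) _ _ fun k => ?_
    by_cases hk : k < n
    · simp only [patch, Finset.mem_range, hk, if_true]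
      exact measurable_const
    · simp only [patch, Finset.mem_range, hk, if_false]
      have h₁ : Measurable[MeasurableSpace.comap (fun x : ℕ → Bool => x k) inferInstance]
          fun x : ℕ → Bool => x k := comap_measurable _
      exact h₁.mono (le_iSup₂_of_le (f := fun i (_ : i ≥ n) =>
        MeasurableSpace.comap (fun x : ℕ → Bool => x i) inferInstance) k (not_lt.1 hk) le_rfl)
        le_rfl
  exact hmeas hTmeas

lemma charFunctions_tail {F : Filter ℕ} (hF : F ≤ cofinite) {x y : ℕ → Bool}
    (hxy : ∀ᶠ n in atTop, x n = true → y n = true) (hx : x ∈ charFunctions F) :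
    y ∈ charFunctions F := by
  rw [← Nat.cofinite_eq_atTop] at hxy
  have h₁ : ∀ᶠ n in F, x n = true := hx
  filter_upwards [h₁, hF hxy] with n h₁ h₂ using h₂ h₁

/-- If the parameters are at most `1 / 2`, a measurable nonprincipal filter is null. -/
lemma bernoulliPi_charFunctions_eq_zero {a : ℕ → unitInterval} (ha : ∀ n, (a n : ℝ) ≤ 1 / 2)
    {F : Filter ℕ} (hF : IsNonprincipalFilter F)
    (hm : NullMeasurableSet (charFunctions F) (bernoulliPi a)) :
    bernoulliPi a (charFunctions F) = 0 := by
  refine (bernoulliPi_zero_or_one a fun x y hxy => charFunctions_tail hF.2 ?_).resolve_right ?_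
  · filter_upwards [hxy] with n hn h using hn ▸ h
  · intro h1
    obtain ⟨x, hx, y, hy, hxy⟩ := exists_disjoint_of_ae_mem ha ((prob_compl_eq_zero_iff₀ hm).2 h1)
    have h₁ : ∀ᶠ n in F, x n = true := hx
    have h₂ : ∀ᶠ n in F, y n = true := hy
    have := hF.1
    obtain ⟨n, hn⟩ := (h₁.and h₂).exists
    exact hxy n hn

lemma muHat_eq_bernoulliPi (p : ℕ → Set.Ioc (0 : ℝ) (1 / 2)) :
    muHat p = bernoulliPi fun n => toUnit (p n) := rfl

/-! ### Enlarging a trace by random sets -/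

/-- The intersection of `I` with the set that has characteristic function `x`. -/
def blockTrace (I : Finset ℕ) (x : ℕ → Bool) : Finset ℕ :=
  I.filter fun n => x n = true

lemma mem_blockTrace {I : Finset ℕ} {x : ℕ → Bool} {n : ℕ} :
    n ∈ blockTrace I x ↔ n ∈ I ∧ x n = true := by
  simp [blockTrace]

lemma blockTrace_subset (I : Finset ℕ) (x : ℕ → Bool) : blockTrace I x ⊆ I :=
  Finset.filter_subset _ _

lemma blockTrace_congr {I : Finset ℕ} {x y : ℕ → Bool} (h : ∀ i ∈ I, x i = y i) :
    blockTrace I x = blockTrace I y :=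
  Finset.filter_congr fun i hi => by rw [h i hi]

lemma dependsOnCoords_blockTrace (I : Finset ℕ) (P : Finset ℕ → Prop) :
    DependsOnCoords I {x | P (blockTrace I x)} := fun x y hxy hx => by
  have h : P (blockTrace I x) := hx
  rwa [blockTrace_congr hxy] at h

lemma measurable_comp_blockTrace {β : Type*} [MeasurableSpace β] (I : Finset ℕ)
    (f : Finset ℕ → β) : Measurable fun x => f (blockTrace I x) :=
  fun s _ => (dependsOnCoords_blockTrace I fun u => f u ∈ s).measurableSet

/-- The parameters of the random set whose union with `j` independent random sets with parameters
`p` is a random set with parameters `q`. -/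
noncomputable def residualParam (p q : ℕ → Set.Ioc (0 : ℝ) (1 / 2)) (j : ℕ) (n : ℕ) : unitInterval :=
  Set.projIcc 0 1 zero_le_one (1 - (1 - (q n : ℝ)) / (1 - (p n : ℝ)) ^ j)

/-- Bernoulli's inequality gives `(1 - p) ^ j ≥ 1 - j * p ≥ 1 - q`, so the projection onto the unit
interval changes nothing. -/
lemma coe_residualParam {p q : ℕ → Set.Ioc (0 : ℝ) (1 / 2)} {j n : ℕ}
    (h : j * (p n : ℝ) ≤ q n) :
    (residualParam p q j n : ℝ) = 1 - (1 - (q n : ℝ)) / (1 - (p n : ℝ)) ^ j := by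
  have hp := (p n).2
  have hq := (q n).2
  have hpos : 0 < (1 - (p n : ℝ)) ^ j := pow_pos (by linarith [hp.2]) j
  have hb : 1 - (j : ℝ) * p n ≤ (1 - (p n : ℝ)) ^ j := by
    have := one_add_mul_le_pow (a := -(p n : ℝ)) (by linarith [hp.2]) j
    simpa [sub_eq_add_neg] using this
  have h₁ : (1 - (q n : ℝ)) / (1 - (p n : ℝ)) ^ j ≤ 1 := by
    rw [div_le_one hpos]; linarith
  have h₂ : 0 ≤ (1 - (q n : ℝ)) / (1 - (p n : ℝ)) ^ j := div_nonneg (by linarith [hq.2]) hpos.le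
  rw [residualParam, Set.projIcc_of_mem]
  exact ⟨by linarith, by linarith⟩

lemma residualParam_succ {p q : ℕ → Set.Ioc (0 : ℝ) (1 / 2)} {j n : ℕ}
    (h : (j + 1 : ℕ) * (p n : ℝ) ≤ q n) :
    1 - (residualParam p q j n : ℝ) =
      (1 - (toUnit (p n) : ℝ)) * (1 - (residualParam p q (j + 1) n : ℝ)) := by
  have hp := (p n).2
  have h' : (j : ℝ) * p n ≤ q n := by
    push_cast at h
    linarith [hp.1]
  have hpos : (1 - (p n : ℝ)) ≠ 0 := by linarith [hp.2]
  rw [coe_residualParam h, coe_residualParam h']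
  simp only [toUnit]
  field_simp
  ring

lemma residualParam_zero (p q : ℕ → Set.Ioc (0 : ℝ) (1 / 2)) :
    residualParam p q 0 = fun n => toUnit (q n) := by
  funext n
  ext
  rw [coe_residualParam (by simpa using (q n).2.1.le)]
  simp [toUnit]

/-- The bounds on the measures of the sets that are to be avoided. -/
noncomputable def smallBound (m : ℕ) : ENNReal := 2⁻¹ * ((8 ^ m)⁻¹) ^ m

/-- `V`, the union of the traces of `j` sets on the block `I`, is still likely to avoid `J` after it
has been enlarged to a random set with parameters `q`. -/
def IsGood (p q : ℕ → Set.Ioc (0 : ℝ) (1 / 2)) (I : Finset ℕ) (J : Set (Finset ℕ)) (m j : ℕ)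
    (V : Finset ℕ) : Prop :=
  bernoulliPi (residualParam p q j) {z | V ∪ blockTrace I z ∈ J} ≤ smallBound m * (8 ^ m) ^ j

lemma isGood_zero {p q : ℕ → Set.Ioc (0 : ℝ) (1 / 2)} {I : Finset ℕ} {J : Set (Finset ℕ)} {m : ℕ}
    (h : muHat q {x | blockTrace I x ∈ J} ≤ smallBound m) : IsGood p q I J m 0 ∅ := by
  simpa [IsGood, residualParam_zero, ← muHat_eq_bernoulliPi] using h

/-- This fixes the size of `smallBound`: after up to `m` losses of a factor `8 ^ m` the probability
is still below one, so `J` can be avoided. -/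
lemma smallBound_mul_pow_le {m j : ℕ} (hj : j ≤ m) : smallBound m * (8 ^ m) ^ j ≤ 2⁻¹ := by
  have h8 : ((8 : ENNReal) ^ m) ≠ 0 := by positivity
  have h8' : ((8 : ENNReal) ^ m) ≠ ⊤ := by finiteness
  calc smallBound m * (8 ^ m) ^ j ≤ smallBound m * (8 ^ m) ^ m := by
        gcongr
        exact one_le_pow₀ (by norm_num)
    _ = 2⁻¹ := by
        rw [smallBound, mul_assoc, ← mul_pow, ENNReal.inv_mul_cancel h8 h8', one_pow, mul_one]

lemma IsGood.exists_notMem {p q : ℕ → Set.Ioc (0 : ℝ) (1 / 2)} {I : Finset ℕ}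
    {J : Set (Finset ℕ)} {m j : ℕ} {V : Finset ℕ} (h : IsGood p q I J m j V) (hj : j ≤ m) :
    ∃ z, V ∪ blockTrace I z ∉ J := by
  by_contra! hall
  have h1 : bernoulliPi (residualParam p q j) {z | V ∪ blockTrace I z ∈ J} = 1 := by
    have : {z | V ∪ blockTrace I z ∈ J} = Set.univ := Set.eq_univ_of_forall hall
    rw [this, measure_univ]
  have := (h1.symm.le.trans h).trans (smallBound_mul_pow_le hj)
  exact absurd this (by simp [ENNReal.one_le_inv])

/-- A residual set of level `j` is the union of a `p`-random set and an independent residual set of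
level `j + 1`. Hence the level `j + 1` probabilities average to the level `j` one, and Markov's
inequality applies with a bound larger by `8 ^ m`. -/
lemma IsGood.measure_not_isGood_le {p q : ℕ → Set.Ioc (0 : ℝ) (1 / 2)} {I : Finset ℕ}
    {J : Set (Finset ℕ)} {m j : ℕ} {V : Finset ℕ} (h : IsGood p q I J m j V)
    (hpq : ∀ n ∈ I, (j + 1 : ℕ) * (p n : ℝ) ≤ q n) :
    muHat p {x | ¬ IsGood p q I J m (j + 1) (V ∪ blockTrace I x)} ≤ (8 ^ m)⁻¹ := by
  have h8 : ((8 : ENNReal) ^ m) ≠ 0 := by positivity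
  have h8' : ((8 : ENNReal) ^ m) ≠ ⊤ := by finiteness
  set c : ENNReal := smallBound m * (8 ^ m) ^ (j + 1) with hc
  have hc0 : c ≠ 0 := by
    simp [hc, smallBound]
  have hct : c ≠ ⊤ := by
    rw [hc, smallBound]
    finiteness
  set f : (ℕ → Bool) → ENNReal := fun x => bernoulliPi (residualParam p q (j + 1))
    {y | V ∪ blockTrace I x ∪ blockTrace I y ∈ J} with hf
  have hfm : Measurable f := measurable_comp_blockTrace I fun u =>
    bernoulliPi (residualParam p q (j + 1)) {y | V ∪ u ∪ blockTrace I y ∈ J}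
  have hint : ∫⁻ x, f x ∂muHat p =
      bernoulliPi (residualParam p q j) {z | V ∪ blockTrace I z ∈ J} := by
    rw [bernoulliPi_or (dependsOnCoords_blockTrace I fun u => V ∪ u ∈ J)
      (a := fun n => toUnit (p n)) fun n hn => residualParam_succ (hpq n hn)]
    refine lintegral_congr fun x => congrArg _ (Set.ext fun y => ?_)
    have : V ∪ blockTrace I x ∪ blockTrace I y = V ∪ blockTrace I fun n => x n || y n := by
      ext n
      simp only [Finset.mem_union, mem_blockTrace, Bool.or_eq_true]
      tauto
    simp only [Set.mem_ofPred_eq, this]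
  have hmarkov := mul_meas_ge_le_lintegral (μ := muHat p) hfm c
  rw [hint] at hmarkov
  have hle : c * muHat p {x | c ≤ f x} ≤ c * (8 ^ m)⁻¹ := by
    refine (hmarkov.trans h).trans (le_of_eq ?_)
    rw [hc, pow_succ, mul_assoc, mul_assoc, ENNReal.mul_inv_cancel h8 h8', mul_one]
  refine (measure_mono fun x hx => ?_).trans ((ENNReal.mul_le_mul_iff_right hc0 hct).1 hle)
  exact (not_le.1 hx).le

/-- For Borel–Cantelli: two slaloms give at most `(2 * m + 1) ^ 2` pairs at `m`, and each pair fails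
with probability at most `(8 ^ m)⁻¹`. -/
lemma tsum_slalom_bound_ne_top :
    ∑' m : ℕ, (((2 * m + 1 : ℕ) : ENNReal) * ((2 * m + 1 : ℕ) : ENNReal)) * (8 ^ m)⁻¹ ≠ ⊤ := by
  have hle : ∀ m : ℕ, (((2 * m + 1 : ℕ) : ENNReal) * ((2 * m + 1 : ℕ) : ENNReal)) * (8 ^ m)⁻¹ ≤
      4 * 2⁻¹ ^ m := by
    intro m
    have h₁ : 2 * m + 1 ≤ 2 * 2 ^ m := by
      have := Nat.lt_two_pow_self (n := m)
      omega
    have h₂ : ((2 * m + 1 : ℕ) : ENNReal) ≤ 2 * 2 ^ m := by exact_mod_cast h₁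
    have h2 : ((2 : ENNReal) ^ m) ≠ 0 := by positivity
    have h2' : ((2 : ENNReal) ^ m) ≠ ⊤ := by finiteness
    calc _ ≤ (2 * 2 ^ m) * (2 * 2 ^ m) * ((8 : ENNReal) ^ m)⁻¹ := by gcongr
      _ = (2 * 2 ^ m) * (2 * 2 ^ m) * ((2 ^ m)⁻¹ * (2 ^ m)⁻¹ * (2 ^ m)⁻¹) := by
          have : (8 : ENNReal) ^ m = 2 ^ m * 2 ^ m * 2 ^ m := by
            rw [← mul_pow, ← mul_pow]; norm_num
          rw [this, ENNReal.mul_inv (by simp) (by simp), ENNReal.mul_inv (by simp) (by simp)]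
      _ = 4 * (2 ^ m * (2 ^ m)⁻¹) * (2 ^ m * (2 ^ m)⁻¹) * (2 ^ m)⁻¹ := by ring
      _ = 4 * 2⁻¹ ^ m := by
          rw [ENNReal.mul_inv_cancel h2 h2', mul_one, mul_one, ENNReal.inv_pow]
  refine ne_top_of_le_ne_top ?_ (ENNReal.tsum_le_tsum hle)
  rw [ENNReal.tsum_mul_left, ENNReal.tsum_geometric, ENNReal.one_sub_inv_two, inv_inv]
  finiteness

/-! ### Generic members of the filters -/

lemma mk_finset_lt_continuum {ι : Type} (hι : Cardinal.mk ι < Cardinal.continuum) :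
    Cardinal.mk (Finset ι) < Cardinal.continuum := by
  rcases finite_or_infinite ι with h | h
  · exact (Cardinal.lt_aleph0_of_finite _).trans Cardinal.aleph0_lt_continuum
  · rwa [Cardinal.mk_finset_of_infinite]

/-- Under Martin's Axiom a set of positive outer measure has an element `x` whose traces keep all
finite unions of traces of fewer than continuum many given sets good. -/
lemma exists_generic_next (hMA : MartinsAxiom) {ι : Type}
    (hι : Cardinal.mk ι < Cardinal.continuum) {p q : ℕ → Set.Ioc (0 : ℝ) (1 / 2)}
    {I : ℕ → Finset ℕ} (J : ℕ → Set (Finset ℕ)) (hpq : ∀ m, ∀ n ∈ I m, m * (p n : ℝ) ≤ q n)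
    {S : ℕ → Finset (ℕ × Finset ℕ)} (hS : ∀ m, (S m).card ≤ 2 * m + 1)
    {C : Set (ℕ → Bool)} (hC : muHat p C ≠ 0) (X : ι → ℕ → Bool) :
    ∃ x ∈ C, ∀ A : Finset ι, ∀ᶠ m in atTop, ∀ w ∈ S m,
      IsGood p q (I m) (J m) m (w.1 + A.card)
        (w.2 ∪ A.biUnion fun ξ => blockTrace (I m) (X ξ)) →
      w.1 + A.card + 1 ≤ m →
      IsGood p q (I m) (J m) m (w.1 + A.card + 1)
        (w.2 ∪ A.biUnion (fun ξ => blockTrace (I m) (X ξ)) ∪ blockTrace (I m) x) := by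
  -- The possibly uncountably many sets `A` leave only `2 * m + 1` candidates at each `m`. The
  -- cardinality is recorded because goodness depends on the level.
  obtain ⟨T, hTcard, hT⟩ := hMA.exists_slalom (mk_finset_lt_continuum hι)
    fun (A : Finset ι) m => (A.card, A.biUnion fun ξ => blockTrace (I m) (X ξ))
  let H : ℕ → (ℕ → Bool) → Prop := fun m x => ∃ t ∈ T m, ∃ w ∈ S m,
    IsGood p q (I m) (J m) m (w.1 + t.1) (w.2 ∪ t.2) ∧ w.1 + t.1 + 1 ≤ m ∧
      ¬ IsGood p q (I m) (J m) m (w.1 + t.1 + 1) (w.2 ∪ t.2 ∪ blockTrace (I m) x)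
  have hH : ∀ m, muHat p {x | H m x} ≤
      (((2 * m + 1 : ℕ) : ENNReal) * ((2 * m + 1 : ℕ) : ENNReal)) * (8 ^ m)⁻¹ := by
    intro m
    have hone : ∀ t w : ℕ × Finset ℕ, muHat p {x |
        IsGood p q (I m) (J m) m (w.1 + t.1) (w.2 ∪ t.2) ∧ w.1 + t.1 + 1 ≤ m ∧
        ¬ IsGood p q (I m) (J m) m (w.1 + t.1 + 1) (w.2 ∪ t.2 ∪ blockTrace (I m) x)} ≤
          (8 ^ m)⁻¹ := by
      intro t w
      by_cases h : IsGood p q (I m) (J m) m (w.1 + t.1) (w.2 ∪ t.2) ∧ w.1 + t.1 + 1 ≤ m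
      · refine (measure_mono fun x hx => ?_).trans (h.1.measure_not_isGood_le fun n hn => ?_)
        · exact hx.2.2
        · refine le_trans ?_ (hpq m n hn)
          have := (p n).2.1.le
          gcongr
          exact h.2
      · refine le_of_eq_of_le ?_ zero_le
        refine measure_mono_null (fun x hx => ?_) measure_empty
        exact h ⟨hx.1, hx.2.1⟩
    have hsub : {x | H m x} ⊆ ⋃ t ∈ T m, ⋃ w ∈ S m, {x |
        IsGood p q (I m) (J m) m (w.1 + t.1) (w.2 ∪ t.2) ∧ w.1 + t.1 + 1 ≤ m ∧
        ¬ IsGood p q (I m) (J m) m (w.1 + t.1 + 1) (w.2 ∪ t.2 ∪ blockTrace (I m) x)} := by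
      rintro x ⟨t, ht, w, hw, h⟩
      simp only [Set.mem_iUnion]
      exact ⟨t, ht, w, hw, h⟩
    calc muHat p {x | H m x} ≤ ∑ t ∈ T m, ∑ w ∈ S m, ((8 : ENNReal) ^ m)⁻¹ := by
          refine (measure_mono hsub).trans ((measure_biUnion_finset_le _ _).trans ?_)
          refine Finset.sum_le_sum fun t _ => (measure_biUnion_finset_le _ _).trans ?_
          exact Finset.sum_le_sum fun w _ => hone t w
      _ = ((T m).card * (S m).card : ENNReal) * (8 ^ m)⁻¹ := by
          simp [mul_assoc]
      _ ≤ _ := by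
          gcongr
          · exact hTcard m
          · exact hS m
  have hnull : muHat p {x | ∃ᶠ m in atTop, H m x} = 0 :=
    measure_setOfPred_frequently_eq_zero
      (ne_top_of_le_ne_top tsum_slalom_bound_ne_top (ENNReal.tsum_le_tsum hH))
  obtain ⟨x, hxC, hx⟩ : ∃ x ∈ C, ¬ ∃ᶠ m in atTop, H m x := by
    by_contra! hall
    exact hC (measure_mono_null hall hnull)
  refine ⟨x, hxC, fun A => ?_⟩
  filter_upwards [hT A, not_frequently.1 hx] with m hTm hHm w hw hgood hle
  by_contra hbad
  exact hHm ⟨_, hTm, w, hw, hgood, hle, hbad⟩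

/-- Under Martin's Axiom one can choose elements of fewer than continuum many sets of positive
outer measure so that all finite unions of their traces are eventually good. -/
lemma exists_generic_family (hMA : MartinsAxiom) {ι : Type}
    (hι : Cardinal.mk ι < Cardinal.continuum) {p q : ℕ → Set.Ioc (0 : ℝ) (1 / 2)}
    {I : ℕ → Finset ℕ} (J : ℕ → Set (Finset ℕ)) (hpq : ∀ m, ∀ n ∈ I m, m * (p n : ℝ) ≤ q n)
    {S : ℕ → Finset (ℕ × Finset ℕ)} (hS : ∀ m, (S m).card ≤ 2 * m + 1)
    {C : ι → Set (ℕ → Bool)} (hC : ∀ ξ, muHat p (C ξ) ≠ 0) :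
    ∃ X : ι → ℕ → Bool, (∀ ξ, X ξ ∈ C ξ) ∧ ∀ A : Finset ι, ∀ᶠ m in atTop, ∀ w ∈ S m,
      IsGood p q (I m) (J m) m w.1 w.2 → w.1 + A.card ≤ m →
      IsGood p q (I m) (J m) m (w.1 + A.card)
        (w.2 ∪ A.biUnion fun ξ => blockTrace (I m) (X ξ)) := by
  classical
  choose next hnextC hnext using fun (ξ : ι) (X : ι → ℕ → Bool) =>
    exists_generic_next hMA hι (p := p) (q := q) J hpq hS (hC ξ) X
  let _ : LinearOrder ι := linearOrderOfSTO WellOrderingRel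
  have hwf : WellFounded (fun a b : ι => a < b) := IsWellFounded.wf (r := WellOrderingRel)
  -- `X ξ` is generic over the earlier choices. The default value is harmless: a finite set is
  -- treated by adding its maximum last, so only smaller indices are consulted.
  let X : ι → ℕ → Bool := hwf.fix fun ξ prev =>
    next ξ fun η => if h : η < ξ then prev η h else fun _ => false
  have hX : ∀ ξ, X ξ = next ξ fun η => if η < ξ then X η else fun _ => false := by
    intro ξ
    refine (hwf.fix_eq _ ξ).trans ?_
    congr 1
  refine ⟨X, fun ξ => hX ξ ▸ hnextC _ _, fun A => ?_⟩
  induction A using Finset.induction_on_max with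
  | empty => exact Eventually.of_forall fun m w _ hgood _ => by simpa using hgood
  | insert ξ A hlt ih =>
    have hξ : ξ ∉ A := fun h => lt_irrefl _ (hlt ξ h)
    have hn := hnext ξ (fun η => if η < ξ then X η else fun _ => false) A
    rw [← hX ξ] at hn
    filter_upwards [ih, hn] with m h₁ h₂ w hw hgood hle
    rw [Finset.card_insert_of_notMem hξ] at hle ⊢
    have hA : (A.biUnion fun η => blockTrace (I m) (if η < ξ then X η else fun _ => false)) =
        A.biUnion fun η => blockTrace (I m) (X η) :=
      Finset.biUnion_congr rfl fun η hη => by rw [if_pos (hlt η hη)]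
    rw [hA] at h₂
    have := h₂ w hw (h₁ w hw hgood (by omega)) (by omega)
    rw [Finset.biUnion_insert, Finset.union_comm (blockTrace (I m) (X ξ)), ← Finset.union_assoc]
    exact this

/-- Under Martin's Axiom, fewer than continuum many filters of positive outer measure have elements
whose traces on the blocks `I m` are eventually covered by sets `h m` outside of `J m`. -/
theorem exists_block_cover (hMA : MartinsAxiom) {ι : Type}
    (hι : Cardinal.mk ι < Cardinal.continuum) {p q : ℕ → Set.Ioc (0 : ℝ) (1 / 2)}
    {I : ℕ → Finset ℕ} {J : ℕ → Set (Finset ℕ)} (hpq : ∀ m, ∀ n ∈ I m, m * (p n : ℝ) ≤ q n)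
    (hJ : ∀ m, muHat q {x | blockTrace (I m) x ∈ J m} ≤ smallBound m)
    {F : ι → Filter ℕ} (hF : ∀ ξ, muHat p (charFunctions (F ξ)) ≠ 0) :
    ∃ h : ℕ → Finset ℕ, (∀ m, h m ⊆ I m ∧ h m ∉ J m) ∧
      ∀ ξ, ∃ x ∈ charFunctions (F ξ), ∀ᶠ m in atTop, blockTrace (I m) x ⊆ h m := by
  classical
  have hzero : ∀ m, IsGood p q (I m) (J m) m 0 ∅ := fun m => isGood_zero (hJ m)
  obtain ⟨X, hXF, hX⟩ := exists_generic_family hMA hι (p := p) (q := q) J hpq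
    (S := fun _ => {(0, ∅)}) (fun m => by simp) hF
  -- The threshold for goodness of a union over `A ∪ B` need not be bounded by those of `A` and `B`.
  -- A second family `Y`, generic over a slalom capturing the unions from `X`, separates them: `A`
  -- is handled through `X` and `B` through `Y`.
  obtain ⟨S, hScard, hS⟩ := hMA.exists_slalom (mk_finset_lt_continuum hι)
    fun (A : Finset ι) m => (A.card, A.biUnion fun ξ => blockTrace (I m) (X ξ))
  obtain ⟨Y, hYF, hY⟩ := exists_generic_family hMA hι (p := p) (q := q) J hpq hScard hF
  -- The factor two ensures that `A` and `B` together need at most `m` enlargements.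
  have hev : ∀ A : Finset ι, ∃ N : ℕ, ∀ m, N ≤ m → 2 * A.card ≤ m ∧
      (A.card, A.biUnion fun ξ => blockTrace (I m) (X ξ)) ∈ S m ∧
      IsGood p q (I m) (J m) m A.card (A.biUnion fun ξ => blockTrace (I m) (X ξ)) ∧
      ∀ w ∈ S m, IsGood p q (I m) (J m) m w.1 w.2 → w.1 + A.card ≤ m →
        IsGood p q (I m) (J m) m (w.1 + A.card)
          (w.2 ∪ A.biUnion fun ξ => blockTrace (I m) (Y ξ)) := by
    intro A
    refine eventually_atTop.1 ?_
    filter_upwards [eventually_ge_atTop (2 * A.card), hX A, hS A, hY A] with m h₁ h₂ h₃ h₄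
    refine ⟨h₁, h₃, ?_, h₄⟩
    simpa using h₂ (0, ∅) (by simp) (hzero m) (by simp only; omega)
  choose N hN using hev
  obtain ⟨h, hadm, hcover⟩ := hMA.exists_eventually_cover hι
    (fun m h => h ⊆ I m ∧ h ∉ J m)
    -- The intersection is still in the filter, and its trace is covered whether `ξ` is treated
    -- through `X` or through `Y`.
    (fun ξ m h => blockTrace (I m) (fun n => X ξ n && Y ξ n) ⊆ h) N
    (fun A B m hA hB => by
      obtain ⟨hA2, hAS, hAgood, -⟩ := hN A m hA
      obtain ⟨hB2, -, -, hBgood⟩ := hN B m hB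
      have hgood := hBgood _ hAS hAgood (by simp only; omega)
      obtain ⟨z, hz⟩ := hgood.exists_notMem (by simp only; omega)
      refine ⟨_, ⟨?_, hz⟩, fun ξ hξ n hn => ?_, fun ξ hξ n hn => ?_⟩
      · refine Finset.union_subset (Finset.union_subset ?_ ?_) (blockTrace_subset _ _) <;>
          exact Finset.biUnion_subset.2 fun _ _ => blockTrace_subset _ _
      · rw [mem_blockTrace, Bool.and_eq_true] at hn
        refine Finset.mem_union_left _ (Finset.mem_union_left _ (Finset.mem_biUnion.2 ⟨ξ, hξ, ?_⟩))
        exact mem_blockTrace.2 ⟨hn.1, hn.2.1⟩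
      · rw [mem_blockTrace, Bool.and_eq_true] at hn
        refine Finset.mem_union_left _ (Finset.mem_union_right _ (Finset.mem_biUnion.2 ⟨ξ, hξ, ?_⟩))
        exact mem_blockTrace.2 ⟨hn.1, hn.2.2⟩)
    (fun m => by
      obtain ⟨z, hz⟩ := (hzero m).exists_notMem (Nat.zero_le m)
      rw [Finset.empty_union] at hz
      exact ⟨_, blockTrace_subset _ _, hz⟩)
  refine ⟨h, hadm, fun ξ => ⟨_, ?_, hcover ξ⟩⟩
  have h₁ : ∀ᶠ n in F ξ, X ξ n = true := hXF ξ
  have h₂ : ∀ᶠ n in F ξ, Y ξ n = true := hYF ξ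
  change ∀ᶠ n in F ξ, (X ξ n && Y ξ n) = true
  filter_upwards [h₁, h₂] with n h₁ h₂
  simp [h₁, h₂]

/-! ### Covers of null sets by small two-block sets -/

/-- A null set is contained in the limit superior of a summable sequence of clopen sets. -/
lemma exists_summable_cover (μ : Measure (ℕ → Bool)) [IsFiniteMeasure μ] {N : Set (ℕ → Bool)}
    (hN : μ N = 0) :
    ∃ (C : ℕ → Set (ℕ → Bool)) (d : ℕ → ℕ), (∀ j, DependsOnCoords (Finset.range (d j)) (C j)) ∧
      ∑' j, μ (C j) ≠ ⊤ ∧ ∀ x ∈ N, ∃ᶠ j in atTop, x ∈ C j := by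
  have hopen : ∀ k : ℕ, ∃ U, N ⊆ U ∧ IsOpen U ∧ μ U ≤ 2⁻¹ ^ k := by
    intro k
    obtain ⟨U, hNU, hU, hμU⟩ := N.exists_isOpen_le_add μ (ε := 2⁻¹ ^ k) (by simp)
    exact ⟨U, hNU, hU, by simpa [hN] using hμU⟩
  choose U hNU hUo hμU using hopen
  let V : ℕ → ℕ → Set (ℕ → Bool) := fun k n =>
    {x | ∀ y : ℕ → Bool, (∀ i ∈ Finset.range n, x i = y i) → y ∈ U k}
  have hV : ∀ k m n, m ≤ n → ∀ x y : ℕ → Bool, (∀ i ∈ Finset.range n, x i = y i) →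
      x ∈ V k m → y ∈ V k m := by
    intro k m n hmn x y hxy hx z hz
    refine hx z fun i hi => (hxy i ?_).trans (hz i hi)
    exact Finset.range_mono hmn hi
  -- Sorting the points of `U k` by the least length of an initial segment that forces membership
  -- splits `U k` into disjoint clopen pieces.
  let D : ℕ → ℕ → Set (ℕ → Bool) := fun k n => {x | x ∈ V k n ∧ ∀ m < n, x ∉ V k m}
  have hD : ∀ k n, DependsOnCoords (Finset.range n) (D k n) := by
    intro k n x y hxy hx
    refine ⟨hV k n n le_rfl x y hxy hx.1, fun m hm hy => hx.2 m hm ?_⟩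
    exact hV k m n hm.le y x (fun i hi => (hxy i hi).symm) hy
  have hDU : ∀ k n, D k n ⊆ U k := fun k n x hx => hx.1 x fun _ _ => rfl
  have hdisj : ∀ k, Pairwise (Function.onFun Disjoint (D k)) := by
    intro k m n hmn
    refine Set.disjoint_left.2 fun x hm hn => ?_
    rcases hmn.lt_or_gt with h | h
    · exact hn.2 m h hm.1
    · exact hm.2 n h hn.1
  have hcov : ∀ k, ∀ x ∈ U k, ∃ n, x ∈ D k n := by
    classical
    intro k x hx
    have hex : ∃ n, x ∈ V k n := by
      obtain ⟨I, u, hu, hIu⟩ := isOpen_pi_iff.1 (hUo k) x hx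
      obtain ⟨n, hn⟩ := I.exists_nat_subset_range
      exact ⟨n, fun y hy => hIu fun i hi => hy i (hn hi) ▸ (hu i hi).2⟩
    exact ⟨Nat.find hex, Nat.find_spec hex, fun m hm => Nat.find_min hex hm⟩
  refine ⟨fun j => D j.unpair.1 j.unpair.2, fun j => j.unpair.2, fun j => hD _ _, ?_, ?_⟩
  · have h₁ : ∑' j : ℕ, μ (D j.unpair.1 j.unpair.2) = ∑' (k : ℕ) (n : ℕ), μ (D k n) := by
      rw [← ENNReal.tsum_prod]
      exact Nat.pairEquiv.symm.tsum_eq fun z : ℕ × ℕ => μ (D z.1 z.2)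
    have h₂ : ∀ k, ∑' n, μ (D k n) ≤ 2⁻¹ ^ k := by
      intro k
      rw [← measure_iUnion (hdisj k) fun n => (hD k n).measurableSet]
      exact (measure_mono (Set.iUnion_subset (hDU k))).trans (hμU k)
    rw [h₁]
    refine ne_top_of_le_ne_top ?_ (ENNReal.tsum_le_tsum h₂)
    rw [ENNReal.tsum_geometric, ENNReal.one_sub_inv_two, inv_inv]
    finiteness
  · intro x hx
    refine frequently_atTop.2 fun k => ?_
    obtain ⟨n, hn⟩ := hcov k x (hNU k hx)
    exact ⟨Nat.pair k n, Nat.left_le_pair k n, by simpa using hn⟩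

/-- A positive lower bound for the measure of a basic open set given by `a` coordinates. -/
noncomputable def atomBound (q : ℕ → Set.Ioc (0 : ℝ) (1 / 2)) (a : ℕ) : ENNReal :=
  ∏ i ∈ Finset.range a, ENNReal.ofReal (q i)

lemma atomBound_ne_zero (q : ℕ → Set.Ioc (0 : ℝ) (1 / 2)) (a : ℕ) : atomBound q a ≠ 0 :=
  Finset.prod_ne_zero_iff.2 fun i _ => by simpa using (q i).2.1

lemma atomBound_ne_top (q : ℕ → Set.Ioc (0 : ℝ) (1 / 2)) (a : ℕ) : atomBound q a ≠ ⊤ :=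
  ENNReal.prod_ne_top fun _ _ => ENNReal.ofReal_ne_top

lemma atomBound_le (q : ℕ → Set.Ioc (0 : ℝ) (1 / 2)) (a : ℕ) (w : ℕ → Bool) :
    atomBound q a ≤ muHat q {y | ∀ i ∈ Finset.range a, y i = w i} := by
  have h : {y : ℕ → Bool | ∀ i ∈ Finset.range a, y i = w i} =
      ((Finset.range a : Finset ℕ) : Set ℕ).pi fun i => {w i} := by
    ext y
    simp [Set.mem_pi]
  rw [h, muHat, Measure.infinitePi_pi _ fun i _ => by simp]
  refine Finset.prod_le_prod' fun i _ => ?_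
  cases w i
  · rw [bernoulliMeasure_false]
    refine ENNReal.ofReal_le_ofReal ?_
    simp only [toUnit]
    linarith [(q i).2.2]
  · rw [bernoulliMeasure_true]
    rfl

/-- The sequences that agree with an element of `E` from `a` on. -/
def tailSaturation (a : ℕ) (E : Set (ℕ → Bool)) : Set (ℕ → Bool) :=
  {x | ∃ w ∈ E, ∀ i, a ≤ i → x i = w i}

lemma DependsOnCoords.tailSaturation {b : ℕ} {E : Set (ℕ → Bool)}
    (hE : DependsOnCoords (Finset.range b) E) (a : ℕ) :
    DependsOnCoords (Finset.Ico a b) (tailSaturation a E) := by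
  rintro x y hxy ⟨w, hw, hxw⟩
  refine ⟨fun i => if i < a then w i else y i, hE w _ (fun i hi => ?_) hw, fun i hi => ?_⟩
  · by_cases hia : i < a
    · simp [hia]
    · have hia' := not_lt.1 hia
      simp only [hia, if_false]
      rw [← hxw i hia', hxy i (Finset.mem_Ico.2 ⟨hia', Finset.mem_range.1 hi⟩)]
  · simp [not_lt.2 hi]

/-- Given a tail that extends to a point of `E`, the right first `a` coordinates occur independently
with probability at least `atomBound q a`. So forgetting these coordinates costs at most the inverse
of that factor. -/
lemma atomBound_mul_tailSaturation_le (q : ℕ → Set.Ioc (0 : ℝ) (1 / 2)) {a b : ℕ}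
    {E : Set (ℕ → Bool)} (hE : DependsOnCoords (Finset.range b) E) :
    atomBound q a * muHat q (tailSaturation a E) ≤ muHat q E := by
  have hm := (hE.tailSaturation a).measurableSet
  rw [muHat_eq_bernoulliPi, bernoulliPi_splice hE.measurableSet _ (Finset.Ico a b),
    ← setLIntegral_const]
  refine (lintegral_mono_ae ?_).trans (setLIntegral_le_lintegral _ _)
  refine (ae_restrict_iff' hm).2 (Eventually.of_forall fun x hx => ?_)
  obtain ⟨w, hw, hxw⟩ := hx
  refine (atomBound_le q a w).trans (measure_mono fun y hy => hE w _ (fun i hi => ?_) hw)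
  by_cases hia : a ≤ i
  · have : i ∈ Finset.Ico a b := Finset.mem_Ico.2 ⟨hia, Finset.mem_range.1 hi⟩
    simp only [this, if_true]
    exact (hxw i hia).symm
  · have : i ∉ Finset.Ico a b := fun h => hia (Finset.mem_Ico.1 h).1
    simp only [this, if_false]
    exact (hy i (Finset.mem_range.2 (not_le.1 hia))).symm

/-- A null set is contained in the limit superior of small sets that depend on two consecutive
intervals of a partition, which may be chosen as coarse as one likes. -/
theorem exists_two_block_cover (q : ℕ → Set.Ioc (0 : ℝ) (1 / 2)) {N : Set (ℕ → Bool)}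
    (hN : muHat q N = 0) (K : ℕ → ℕ) (δ : ℕ → ENNReal) (hδ : ∀ l, δ l ≠ 0) :
    ∃ (n : ℕ → ℕ) (J : ℕ → Set (Finset ℕ)), StrictMono n ∧ (∀ l, K l ≤ n l) ∧
      (∀ l, muHat q {x | blockTrace (Finset.Ico (n l) (n (l + 2))) x ∈ J l} ≤ δ l) ∧
      ∀ x ∈ N, ∃ᶠ l in atTop, blockTrace (Finset.Ico (n l) (n (l + 2))) x ∈ J l := by
  have : IsProbabilityMeasure (muHat q) := by rw [muHat_eq_bernoulliPi]; infer_instance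
  obtain ⟨C, d, hCd, hsum, hfreq⟩ := exists_summable_cover (muHat q) hN
  have htail : ∀ l a : ℕ, ∃ j, l ≤ j ∧ ∑' i, muHat q (C (i + j)) ≤ δ l * atomBound q a := by
    intro l a
    have hpos : 0 < δ l * atomBound q a :=
      pos_iff_ne_zero.2 (mul_ne_zero (hδ l) (atomBound_ne_zero q a))
    exact ((eventually_ge_atTop l).and
      ((ENNReal.tendsto_sum_nat_add _ hsum).eventually_le_const hpos)).exists
  choose jf hjf hjtail using htail
  -- First `n l` is fixed, then `j l` is chosen so that the clopen sets from `j l` on are small even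
  -- after division by `atomBound q (n l)`, then `n (l + 1)` passes the supports of all sets before
  -- `j l`. Hence the sets between `j l` and `j (l + 1)` live below `n (l + 2)`.
  let n : ℕ → ℕ := fun l => Nat.rec (K 0)
    (fun l a => max (max (a + 1) (K (l + 1))) ((Finset.range (jf l a)).sup d)) l
  have hnsucc : ∀ l, n (l + 1) =
      max (max (n l + 1) (K (l + 1))) ((Finset.range (jf l (n l))).sup d) := fun l => rfl
  let j : ℕ → ℕ := fun l => jf l (n l)
  let E : ℕ → Set (ℕ → Bool) := fun l => ⋃ i ∈ Finset.Ico (j l) (j (l + 1)), C i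
  have hE : ∀ l, DependsOnCoords (Finset.range (n (l + 2))) (E l) := by
    intro l x y hxy hx
    simp only [E, Set.mem_iUnion] at hx ⊢
    obtain ⟨i, hi, hxi⟩ := hx
    refine ⟨i, hi, hCd i x y (fun k hk => hxy k ?_) hxi⟩
    rw [Finset.mem_range] at hk ⊢
    refine hk.trans_le ?_
    rw [hnsucc (l + 1)]
    exact (Finset.le_sup (f := d) (Finset.mem_range.2 (Finset.mem_Ico.1 hi).2)).trans
      (le_max_right _ _)
  have hEμ : ∀ l, muHat q (E l) ≤ δ l * atomBound q (n l) := by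
    intro l
    refine le_trans ?_ (hjtail l (n l))
    calc muHat q (E l) ≤ muHat q (⋃ i, C (i + j l)) := by
          refine measure_mono fun x hx => ?_
          simp only [E, Set.mem_iUnion] at hx ⊢
          obtain ⟨i, hi, hxi⟩ := hx
          refine ⟨i - j l, ?_⟩
          rwa [Nat.sub_add_cancel (Finset.mem_Ico.1 hi).1]
      _ ≤ _ := measure_iUnion_le _
  let J : ℕ → Set (Finset ℕ) := fun l =>
    {u | ∃ x ∈ tailSaturation (n l) (E l), blockTrace (Finset.Ico (n l) (n (l + 2))) x = u}
  have hJ : ∀ l, {x | blockTrace (Finset.Ico (n l) (n (l + 2))) x ∈ J l} =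
      tailSaturation (n l) (E l) := by
    intro l
    ext x
    refine ⟨?_, fun hx => ⟨x, hx, rfl⟩⟩
    rintro ⟨y, hy, hyx⟩
    refine (hE l).tailSaturation (n l) y x (fun i hi => ?_) hy
    have := Finset.ext_iff.1 hyx i
    simp only [mem_blockTrace, hi, true_and] at this
    exact Bool.eq_iff_iff.2 this
  refine ⟨n, J, strictMono_nat_of_lt_succ fun l => ?_, fun l => ?_, fun l => ?_, fun x hx => ?_⟩
  · rw [hnsucc l]
    exact (Nat.lt_succ_self _).trans_le ((le_max_left _ _).trans (le_max_left _ _))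
  · cases l with
    | zero => exact le_rfl
    | succ l =>
      rw [hnsucc l]
      exact (le_max_right _ _).trans (le_max_left _ _)
  · rw [hJ l]
    have h := (atomBound_mul_tailSaturation_le q (a := n l) (hE l)).trans (hEμ l)
    rw [mul_comm (δ l)] at h
    exact (ENNReal.mul_le_mul_iff_right (atomBound_ne_zero q _) (atomBound_ne_top q _)).1 h
  · classical
    refine frequently_atTop.2 fun L => ?_
    obtain ⟨i, hi, hxi⟩ := frequently_atTop.1 (hfreq x hx) (j L)
    -- Since `j l ≥ l`, every index from `j L` on falls between consecutive values of `j`.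
    have hex : ∃ k, i < j (L + k) :=
      ⟨i + 1, by have := hjf (L + (i + 1)) (n (L + (i + 1))); simp only [j]; omega⟩
    have hspec := Nat.find_spec hex
    obtain ⟨k, hk⟩ : ∃ k, Nat.find hex = k + 1 := by
      refine Nat.exists_eq_succ_of_ne_zero fun h0 => ?_
      rw [h0] at hspec
      exact absurd hspec (not_lt.2 hi)
    have hmin : ¬ i < j (L + k) := Nat.find_min hex (by omega)
    rw [hk] at hspec
    refine ⟨L + k, Nat.le_add_right _ _, ?_⟩
    have hmem : x ∈ {x | blockTrace (Finset.Ico (n (L + k)) (n (L + k + 2))) x ∈ J (L + k)} := by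
      rw [hJ]
      refine ⟨x, ?_, fun _ _ => rfl⟩
      simp only [E, Set.mem_iUnion]
      exact ⟨i, Finset.mem_Ico.2 ⟨not_lt.1 hmin, hspec⟩, hxi⟩
    exact hmem

lemma smallBound_ne_zero (m : ℕ) : smallBound m ≠ 0 := by
  simp [smallBound]

lemma smallBound_ne_top (m : ℕ) : smallBound m ≠ ⊤ := by
  rw [smallBound]
  finiteness

lemma smallBound_antitone : Antitone smallBound := by
  intro m n hmn
  simp only [smallBound, ← ENNReal.inv_pow, ← pow_mul]
  gcongr
  norm_num

/-! ### Building a member of the intersection outside the cover -/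

/-- Markov's inequality for the conditional probability given the trace on `B`. -/
lemma measure_le_conditional_le (q : ℕ → Set.Ioc (0 : ℝ) (1 / 2)) {B B' : Finset ℕ}
    (hB : Disjoint B B') (J : Set (Finset ℕ)) {γ γ' : ENNReal} (h0 : γ ≠ 0) (ht : γ ≠ ⊤)
    (hJ : muHat q {x | blockTrace (B ∪ B') x ∈ J} ≤ γ * γ') :
    muHat q {x | γ ≤ muHat q {y | blockTrace B x ∪ blockTrace B' y ∈ J}} ≤ γ' := by
  have hmarkov := mul_meas_ge_le_lintegral (μ := muHat q)
    (measurable_comp_blockTrace B fun u => muHat q {y | u ∪ blockTrace B' y ∈ J}) γ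
  refine (ENNReal.mul_le_mul_iff_right h0 ht).1 (hmarkov.trans (le_trans (le_of_eq ?_) hJ))
  rw [muHat_eq_bernoulliPi, bernoulliPi_splice
    (dependsOnCoords_blockTrace (B ∪ B') fun u => u ∈ J).measurableSet _ B]
  refine lintegral_congr fun x => congrArg _ (Set.ext fun y => ?_)
  have : blockTrace B x ∪ blockTrace B' y =
      blockTrace (B ∪ B') fun n => if n ∈ B then x n else y n := by
    ext n
    simp only [Finset.mem_union, mem_blockTrace]
    by_cases hn : n ∈ B
    · simp [hn, Finset.disjoint_left.1 hB hn]
    · simp [hn]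
  simp only [Set.mem_ofPred_eq, this]

/-- Under Martin's Axiom, the intersection of fewer than continuum many nonprincipal filters of
positive outer measure for the parameters `p` has positive outer measure for all parameters `q`
with `q n / p n → ∞`. -/
theorem muHat_charFunctions_iSup_ne_zero (hMA : MartinsAxiom) {ι : Type}
    (hι : Cardinal.mk ι < Cardinal.continuum) {p q : ℕ → Set.Ioc (0 : ℝ) (1 / 2)}
    (hpq : Tendsto (fun n => (q n : ℝ) / (p n : ℝ)) atTop atTop)
    {F : ι → Filter ℕ} (hF : ∀ ξ, F ξ ≤ cofinite)
    (hFp : ∀ ξ, muHat p (charFunctions (F ξ)) ≠ 0) :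
    muHat q (charFunctions (⨆ ξ, F ξ)) ≠ 0 := by
  classical
  intro hnull
  have hK : ∀ l : ℕ, ∃ k, ∀ n, k ≤ n → (l : ℝ) * p n ≤ q n := by
    intro l
    refine eventually_atTop.1 ?_
    filter_upwards [hpq.eventually_ge_atTop (l : ℝ)] with n hn
    exact (le_div_iff₀ (p n).2.1).1 hn
  choose K hK using hK
  let γ : ℕ → ENNReal := fun m => smallBound m * 2⁻¹
  have hγ0 : ∀ m, γ m ≠ 0 := fun m => mul_ne_zero (smallBound_ne_zero m) (by simp)
  have hγt : ∀ m, γ m ≠ ⊤ := fun m => ENNReal.mul_ne_top (smallBound_ne_top m) (by simp)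
  have hγanti : ∀ {m k}, m ≤ k → γ k ≤ γ m := fun h =>
    mul_le_mul_left (smallBound_antitone h) _
  have hγadd : ∀ m, γ m + γ m = smallBound m := fun m => by
    simp only [γ]
    rw [← mul_add, ENNReal.inv_two_add_inv_two, mul_one]
  -- The square serves Markov's inequality: a conditional probability is at least `γ` with
  -- probability at most `γ`, and two neighbours together cost `smallBound`.
  obtain ⟨n, J, hn, hKn, hJμ, hJN⟩ := exists_two_block_cover q hnull K (fun l => γ l * γ l)
    fun l => mul_ne_zero (hγ0 l) (hγ0 l)
  let B : ℕ → Finset ℕ := fun l => Finset.Ico (n l) (n (l + 1))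
  have hBunion : ∀ l, Finset.Ico (n l) (n (l + 2)) = B l ∪ B (l + 1) := fun l =>
    (Finset.Ico_union_Ico_eq_Ico (hn (Nat.lt_succ_self l)).le
      (hn (Nat.lt_succ_self (l + 1))).le).symm
  have hBeq : ∀ {k l l'}, k ∈ B l → k ∈ B l' → l = l' := by
    intro k l l' h h'
    rw [Finset.mem_Ico] at h h'
    have h₁ := hn.lt_iff_lt.1 (h.1.trans_lt h'.2)
    have h₂ := hn.lt_iff_lt.1 (h'.1.trans_lt h.2)
    omega
  have hBdisj : ∀ l, Disjoint (B l) (B (l + 1)) := fun l =>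
    Finset.disjoint_left.2 fun k h h' => absurd (hBeq h h') (by omega)
  have hBpq : ∀ m l, m ≤ l → ∀ k ∈ B l, (m : ℝ) * p k ≤ q k := by
    intro m l hml k hk
    refine le_trans ?_ (hK l k ((hKn l).trans (Finset.mem_Ico.1 hk).1))
    have := (p k).2.1.le
    gcongr
  have hJμ' : ∀ m l, m ≤ l →
      muHat q {x | blockTrace (B l ∪ B (l + 1)) x ∈ J l} ≤ γ m * γ m := by
    intro m l hml
    rw [← hBunion]
    exact (hJμ l).trans (mul_le_mul' (hγanti hml) (hγanti hml))
  -- the odd blocks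
  let J₁ : ℕ → Set (Finset ℕ) := fun m =>
    {u | γ m ≤ muHat q {y | u ∪ blockTrace (B (2 * m)) y ∈ J (2 * m)} ∨
      γ m ≤ muHat q {y | u ∪ blockTrace (B (2 * m + 2)) y ∈ J (2 * m + 1)}}
  have hJ₁ : ∀ m, muHat q {x | blockTrace (B (2 * m + 1)) x ∈ J₁ m} ≤ smallBound m := by
    intro m
    rw [← hγadd]
    refine (measure_union_le _ _).trans (add_le_add
      (measure_le_conditional_le q (hBdisj (2 * m)).symm _ (hγ0 m) (hγt m) ?_)
      (measure_le_conditional_le q (hBdisj (2 * m + 1)) _ (hγ0 m) (hγt m) ?_))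
    · rw [Finset.union_comm]
      exact hJμ' m (2 * m) (by omega)
    · exact hJμ' m (2 * m + 1) (by omega)
  obtain ⟨h₁, hh₁, hcov₁⟩ := exists_block_cover hMA hι (p := p) (q := q)
    (I := fun m => B (2 * m + 1)) (J := J₁) (fun m => hBpq m _ (by omega)) hJ₁ hFp
  -- the even blocks
  let J₂ : ℕ → Set (Finset ℕ) := fun m =>
    {w | h₁ m ∪ w ∈ J (2 * m + 1) ∨ h₁ (m + 1) ∪ w ∈ J (2 * m + 2)}
  have hJ₂ : ∀ m, muHat q {x | blockTrace (B (2 * m + 2)) x ∈ J₂ m} ≤ smallBound m := by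
    intro m
    rw [← hγadd]
    have hl := not_or.1 (hh₁ m).2
    have hr := not_or.1 (hh₁ (m + 1)).2
    refine (measure_union_le _ _).trans (add_le_add (not_le.1 hl.2).le ?_)
    exact (not_le.1 hr.1).le.trans (hγanti (Nat.le_succ m))
  obtain ⟨h₂, hh₂, hcov₂⟩ := exists_block_cover hMA hι (p := p) (q := q)
    (I := fun m => B (2 * m + 2)) (J := J₂) (fun m => hBpq m _ (by omega)) hJ₂ hFp
  -- `Z` is empty on block `0`, which is finite and hence irrelevant to the filters; accordingly `J
  -- l` is avoided only for `l ≥ 1`.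
  let Z : ℕ → Bool := fun k => decide (∃ m, k ∈ h₁ m ∨ k ∈ h₂ m)
  have hZ₁ : ∀ m, blockTrace (B (2 * m + 1)) Z = h₁ m := by
    intro m
    ext k
    simp only [mem_blockTrace, Z, decide_eq_true_eq]
    refine ⟨?_, fun hk => ⟨(hh₁ m).1 hk, m, Or.inl hk⟩⟩
    rintro ⟨hk, m', hm' | hm'⟩
    · have := hBeq hk ((hh₁ m').1 hm')
      obtain rfl : m = m' := by omega
      exact hm'
    · have := hBeq hk ((hh₂ m').1 hm')
      omega
  have hZ₂ : ∀ m, blockTrace (B (2 * m + 2)) Z = h₂ m := by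
    intro m
    ext k
    simp only [mem_blockTrace, Z, decide_eq_true_eq]
    refine ⟨?_, fun hk => ⟨(hh₂ m).1 hk, m, Or.inr hk⟩⟩
    rintro ⟨hk, m', hm' | hm'⟩
    · have := hBeq hk ((hh₁ m').1 hm')
      omega
    · have := hBeq hk ((hh₂ m').1 hm')
      obtain rfl : m = m' := by omega
      exact hm'
  have hZF : Z ∈ charFunctions (⨆ ξ, F ξ) := by
    refine mem_iSup.2 fun ξ => ?_
    obtain ⟨x, hxF, hx⟩ := hcov₁ ξ
    obtain ⟨y, hyF, hy⟩ := hcov₂ ξ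
    refine charFunctions_tail (hF ξ) (x := fun k => x k && y k) ?_ ?_
    · obtain ⟨M, hM⟩ := eventually_atTop.1 (hx.and hy)
      filter_upwards [eventually_ge_atTop (n (2 * M + 1))] with k hk hxy
      rw [Bool.and_eq_true] at hxy
      have hex : ∃ l, k < n (l + 1) := ⟨k, (Nat.lt_succ_self k).trans_le (hn.le_apply)⟩
      obtain ⟨l, hl, hlk⟩ : ∃ l, k ∈ B l ∧ 2 * M + 1 ≤ l := by
        have hspec := Nat.find_spec hex
        have hM' : 2 * M + 1 ≤ Nat.find hex := by
          have := hn.lt_iff_lt.1 (hk.trans_lt hspec)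
          omega
        refine ⟨Nat.find hex, Finset.mem_Ico.2 ⟨not_lt.1 fun hlt => ?_, hspec⟩, hM'⟩
        refine Nat.find_min hex (m := Nat.find hex - 1) (by omega) ?_
        rwa [Nat.sub_add_cancel (by omega)]
      simp only [Z, decide_eq_true_eq]
      rcases Nat.even_or_odd' (l - 1) with ⟨m, hm | hm⟩
      · obtain rfl : l = 2 * m + 1 := by omega
        exact ⟨m, Or.inl ((hM m (by omega)).1 (mem_blockTrace.2 ⟨hl, hxy.1⟩))⟩
      · obtain rfl : l = 2 * m + 2 := by omega
        exact ⟨m, Or.inr ((hM m (by omega)).2 (mem_blockTrace.2 ⟨hl, hxy.2⟩))⟩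
    · have h₁ : ∀ᶠ k in F ξ, x k = true := hxF
      have h₂ : ∀ᶠ k in F ξ, y k = true := hyF
      change ∀ᶠ k in F ξ, (x k && y k) = true
      filter_upwards [h₁, h₂] with k h₁ h₂
      simp [h₁, h₂]
  obtain ⟨l, hl1, hl⟩ := frequently_atTop.1 (hJN Z hZF) 1
  have hunion : blockTrace (Finset.Ico (n l) (n (l + 2))) Z =
      blockTrace (B l) Z ∪ blockTrace (B (l + 1)) Z := by
    rw [hBunion, blockTrace, Finset.filter_union]
    rfl
  rw [hunion] at hl
  rcases Nat.even_or_odd' (l - 1) with ⟨m, hm | hm⟩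
  · obtain rfl : l = 2 * m + 1 := by omega
    rw [hZ₁, hZ₂] at hl
    exact (hh₂ m).2 (Or.inl hl)
  · obtain rfl : l = 2 * m + 2 := by omega
    rw [hZ₂, show 2 * m + 2 + 1 = 2 * (m + 1) + 1 by ring, hZ₁, Finset.union_comm] at hl
    exact (hh₂ m).2 (Or.inr hl)

/-- In Mathlib's order on filters, `⨆ ξ, F ξ` is the intersection of the families `F ξ`:
a set belongs to it if and only if it belongs to every `F ξ`. -/
theorem theorem2p4 (hMA : MartinsAxiom)
    (p : ℕ → Set.Ioc (0 : ℝ) (1 / 2)) (hp : Tendsto (fun n => (p n : ℝ)) atTop (𝓝 0))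
    {ι : Type*} [Nonempty ι] (hι : Cardinal.mk ι < Cardinal.continuum)
    (F : ι → Filter ℕ) (hF : ∀ ξ, IsNonprincipalFilter (F ξ))
    (hFp : ∀ ξ, NonmeasurableFilter (muHat p) (F ξ)) :
    IsNonprincipalFilter (⨆ ξ, F ξ) ∧
      NonmeasurableFilter cantorLebesgue (⨆ ξ, F ξ) ∧
      ∀ q : ℕ → Set.Ioc (0 : ℝ) (1 / 2),
        Tendsto (fun n => (q n : ℝ) / (p n : ℝ)) atTop atTop →
          NonmeasurableFilter (muHat q) (⨆ ξ, F ξ) := by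
  have hnp : IsNonprincipalFilter (⨆ ξ, F ξ) := by
    refine ⟨?_, iSup_le fun ξ => (hF ξ).2⟩
    obtain ⟨ξ⟩ := ‹Nonempty ι›
    have := (hF ξ).1
    exact NeBot.mono this (le_iSup F ξ)
  have hmain : ∀ q : ℕ → Set.Ioc (0 : ℝ) (1 / 2),
      Tendsto (fun n => (q n : ℝ) / (p n : ℝ)) atTop atTop →
        NonmeasurableFilter (muHat q) (⨆ ξ, F ξ) := by
    intro q hpq hmeas
    -- Martin's Axiom speaks of `Type`, so the index type is replaced by a set of reals.
    obtain ⟨e⟩ : Nonempty (ι ↪ ℝ) := by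
      rw [← Cardinal.lift_mk_le', Cardinal.mk_real, Cardinal.lift_continuum]
      simpa using hι.le
    let e' : ι ≃ Set.range e := Equiv.ofInjective e e.injective
    have hcard : Cardinal.mk (Set.range e) < Cardinal.continuum := by
      have h := Cardinal.lift_mk_eq'.2 ⟨e'⟩
      rw [← Cardinal.lift_lt, ← h, Cardinal.lift_continuum]
      simpa using hι
    have hsup : (⨆ ξ, F ξ) = ⨆ r, F (e'.symm r) := (e'.symm.iSup_comp (g := F)).symm
    refine muHat_charFunctions_iSup_ne_zero hMA hcard (p := p) (q := q) hpq
      (F := fun r => F (e'.symm r)) (fun r => (hF _).2)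
      (fun r h0 => hFp (e'.symm r) (NullMeasurableSet.of_null h0)) ?_
    rw [← hsup]
    exact bernoulliPi_charFunctions_eq_zero (fun n => (q n).2.2) hnp hmeas
  refine ⟨hnp, hmain _ ?_, hmain⟩
  have hp' : Tendsto (fun n => (p n : ℝ)) atTop (𝓝[>] 0) :=
    tendsto_nhdsWithin_iff.2 ⟨hp, Eventually.of_forall fun n => (p n).2.1⟩
  exact (tendsto_inv_nhdsGT_zero.comp hp').const_mul_atTop (by norm_num)
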